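/- Theorem 4.2. Let $\mathbb{N}$ carry the discrete topology and let $\mathbb{N}^{\mathbb{N}}$ be the Baire space (with the product topology). Let $\mathbb{N}^{\mathbb{N}^{\mathbb{N}}}$ be the Kleene-Kreisel space of level two, that is, the set of all continuous functions $\mathbb{N}^{\mathbb{N}} \to \mathbb{N}$ endowed with the sequentialisation of the compact-open topology (the topology whose closed sets are exactly the sets that are sequentially closed in the compact-open topology); this is the exponential formed in the category $\mathsf{QCB}$ of quotients of countably based topological spaces. A subset $A$ of a topological space $X$ is called functionally closed if $A = f^{-1}[\{0\}]$ for some continuous function $f \colon X \to [0,1]$, and $X$ is said to satisfy Normann's condition if every functionally closed subset of $X$ is an intersection of clopen subsets of $X$. Then the space $\mathbb{N}^{\mathbb{N}^{\mathbb{N}}}$ does not satisfy Normann's condition; that is, there is a functionally closed subset of $\mathbb{N}^{\mathbb{N}^{\mathbb{N}}}$ that is not an intersection of clopen sets. -/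

import Mathlib

open Filter Topology

/-- The union of two sequentially closed sets is sequentially closed. -/
theorem isSeqClosed_union {X : Type*} [TopologicalSpace X] {A B : Set X}
    (hA : IsSeqClosed A) (hB : IsSeqClosed B) : IsSeqClosed (A ∪ B) := by
  intro u x hu hx
  by_cases h : ∃ᶠ n in atTop, u n ∈ A
  · obtain ⟨φ, hφ, hφA⟩ := extraction_of_frequently_atTop h
    exact Or.inl (hA hφA (hx.comp hφ.tendsto_atTop))
  · have h' : ∀ᶠ n in atTop, u n ∈ B := by
      filter_upwards [not_frequently.1 h] with n hn
      exact (hu n).resolve_left hn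
    obtain ⟨φ, hφ, hφB⟩ := extraction_of_frequently_atTop h'.frequently
    exact Or.inr (hB hφB (hx.comp hφ.tendsto_atTop))

/-- The sequentialisation of a topology `t` on `X`: the topology on `X` whose closed sets are
exactly the sequentially closed sets of `t`. -/
@[reducible]
def sequentialisation {X : Type*} (t : TopologicalSpace X) : TopologicalSpace X :=
  TopologicalSpace.ofClosed {A : Set X | @IsSeqClosed X t A}
    (fun _ _ hu _ => (hu 0).elim)
    (fun _ h𝒜 _ _ hu hx A hA => h𝒜 hA (fun n => hu n A hA) hx)
    (fun _ hA _ hB => isSeqClosed_union hA hB)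

/-- The function space `Y ^ X`: the set of continuous functions from `X` to `Y`, carrying the
sequentialisation of the compact-open topology. For sequential spaces `X` and `Y` this is the
exponential in the category of sequential spaces (and in `QCB`, when `X` and `Y` are
qcb-spaces). It is a type synonym of `C(X, Y)`, so that it does not inherit the compact-open
topology itself. -/
def SeqExp (X Y : Type*) [TopologicalSpace X] [TopologicalSpace Y] : Type _ := C(X, Y)

instance (X Y : Type*) [TopologicalSpace X] [TopologicalSpace Y] :
    TopologicalSpace (SeqExp X Y) :=
  sequentialisation (ContinuousMap.compactOpen : TopologicalSpace C(X, Y))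

/-- The Kleene-Kreisel space `ℕ ^ (ℕ ^ ℕ)`: here `ℕ` is discrete and `ℕ → ℕ` is the Baire space,
with the product topology. -/
abbrev KleeneKreiselTwo : Type := SeqExp (ℕ → ℕ) ℕ

/-- A set is functionally closed if it is the preimage of `0` under a continuous function into
the unit interval. -/
def IsFunctionallyClosed {X : Type*} [TopologicalSpace X] (A : Set X) : Prop :=
  ∃ f : X → unitInterval, Continuous f ∧ A = f ⁻¹' {0}

/-- A set is an intersection of clopen sets. -/
def IsInterOfClopens {X : Type*} [TopologicalSpace X] (A : Set X) : Prop :=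
  ∃ 𝒞 : Set (Set X), (∀ C ∈ 𝒞, IsClopen C) ∧ A = ⋂₀ 𝒞

/-- Normann's condition: every functionally closed set is an intersection of clopen sets. -/
def NormannCondition (X : Type*) [TopologicalSpace X] : Prop :=
  ∀ A : Set X, IsFunctionallyClosed A → IsInterOfClopens A

/-!
The proof exhibits complete Erdős space as a retract of `ℕ ^ (ℕ ^ ℕ)`. Here complete Erdős space
is the set of thin sets `S ⊆ ℕ`, those with `‖S‖ = ∑_{m ∈ S} 1 / (m + 1)` finite, with
`ℓ¹`-convergence (`ErdosTendsto`).

A thin set `S` is coded by the functional `thinCode S` that asks of `h : ℕ → ℕ` whether some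
interval `[n, h (n + 1))` carries weight at least `1 / (h 0 + 1)` in `S`. Thinness of `S` makes this
continuous in `h`, and `ℓ¹`-convergence of sets gives convergence of the codes in the compact-open
topology (`ErdosTendsto.tendsto_thinCode`). Conversely, every functional `G` makes claims about the
weights of intervals through its values at the points `(i, 0, …, 0, k, 0, …)`, and `decode G` is the
set it claims to code, cut off at the first inconsistency. The points `(i, 0, …, 0, k, 0, …)`, with
`k` in position `n + 1`, tend to `(i, 0, 0, …)` as `n → ∞`, uniformly in `k`. Convergence of
functionals is eventual equality on compact sets, so along a convergent sequence the tails of the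
decoded sets are uniformly small: decoding is sequentially continuous for `ℓ¹`-convergence
(`erdosTendsto_decode`), and `decode (thinCode S) = S` (`decode_thinCode`).

Hence `G ↦ max 0 (1 - ‖decode G‖)` is continuous for the sequential topology. A clopen set
containing its zero set but not the code of `∅` would cut out, in complete Erdős space, a clopen
neighbourhood of `∅` of sets of norm less than `1`. Erdős's argument rules this out
(`exists_erdosTendsto_boundary`): one adds numbers to a finite set as long as it stays inside, the
divergence of the harmonic series forces an exit, and repeating this beyond larger and larger
numbers gives a thin set that is a limit both of sets inside and of sets outside.
-/

/-! ### Harmonic weights of sets of natural numbers -/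

/-- The weight `∑ 1 / (m + 1)` of the part of `S` that lies in the interval `[a, b)`. -/
noncomputable def weight (S : Set ℕ) (a b : ℕ) : ℝ :=
  ∑ m ∈ Finset.Ico a b, S.indicator (fun m : ℕ => 1 / ((m : ℝ) + 1)) m

theorem indicator_harmonic_nonneg (S : Set ℕ) (m : ℕ) :
    0 ≤ S.indicator (fun m : ℕ => 1 / ((m : ℝ) + 1)) m :=
  Set.indicator_nonneg (fun m _ => by positivity) m

theorem weight_eq_zero_of_le (S : Set ℕ) {a b : ℕ} (h : b ≤ a) : weight S a b = 0 := by
  simp [weight, Finset.Ico_eq_empty_of_le h]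

theorem weight_anti_left (S : Set ℕ) {a a' : ℕ} (h : a ≤ a') (b : ℕ) :
    weight S a' b ≤ weight S a b :=
  Finset.sum_le_sum_of_subset_of_nonneg (Finset.Ico_subset_Ico_left h)
    fun m _ _ => indicator_harmonic_nonneg S m

theorem weight_mono_set {S T : Set ℕ} (h : S ⊆ T) (a b : ℕ) : weight S a b ≤ weight T a b :=
  Finset.sum_le_sum fun _ _ =>
    Set.indicator_le_indicator_of_subset h (fun _ => by positivity) _

theorem weight_congr {S T : Set ℕ} {a b : ℕ} (h : ∀ m < b, m ∈ S ↔ m ∈ T) :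
    weight S a b = weight T a b := by
  refine Finset.sum_congr rfl fun m hm => ?_
  have := h m (Finset.mem_Ico.1 hm).2
  by_cases hS : m ∈ S
  · simp [hS, this.1 hS]
  · simp [hS, mt this.2 hS]

theorem weight_succ_of_mem {S : Set ℕ} {a b : ℕ} (hab : a ≤ b) (hb : b ∈ S) :
    weight S a (b + 1) = weight S a b + 1 / ((b : ℝ) + 1) := by
  simp [weight, Finset.sum_Ico_succ_top hab, hb]

theorem weight_succ_of_notMem {S : Set ℕ} {a b : ℕ} (hb : b ∉ S) :
    weight S a (b + 1) = weight S a b := by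
  rcases le_or_gt a b with hab | hab
  · simp [weight, Finset.sum_Ico_succ_top hab, hb]
  · rw [weight_eq_zero_of_le S hab, weight_eq_zero_of_le S hab.le]

theorem weight_insert_le (S : Set ℕ) (r a b : ℕ) :
    weight (insert r S) a b ≤ weight S a b + 1 / ((r : ℝ) + 1) := by
  have h0 : (0 : ℝ) < 1 / ((r : ℝ) + 1) := by positivity
  have hm : ∀ m, (insert r S).indicator (fun m : ℕ => 1 / ((m : ℝ) + 1)) m ≤
      S.indicator (fun m : ℕ => 1 / ((m : ℝ) + 1)) m + if m = r then 1 / ((r : ℝ) + 1) else 0 := by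
    intro m
    by_cases hmr : m = r
    · subst hmr
      simpa using indicator_harmonic_nonneg S m
    · by_cases hS : m ∈ S <;> simp [hmr, hS]
  refine (Finset.sum_le_sum fun m _ => hm m).trans ?_
  rw [Finset.sum_add_distrib, Finset.sum_ite_eq']
  refine add_le_add le_rfl ?_
  split_ifs
  exacts [le_rfl, h0.le]

/-! ### Thin sets and `ℓ¹`-convergence -/

/-- A sequence of sets converges to `T` when membership of every number stabilises and the tails
of the harmonic sums are uniformly small: this is `ℓ¹`-convergence of the indicator functions
weighted by `1 / (m + 1)`. -/
def ErdosTendsto (S : ℕ → Set ℕ) (T : Set ℕ) : Prop :=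
  (∀ m, ∀ᶠ j in atTop, (m ∈ S j ↔ m ∈ T)) ∧
    ∀ ε : ℝ, 0 < ε → ∃ N, ∀ᶠ j in atTop, ∀ b, weight (S j) N b < ε

/-- A set of natural numbers is thin when its harmonic sum converges, expressed by Cauchy's
criterion. The thin sets are the points of complete Erdős space. -/
def IsThin (S : Set ℕ) : Prop :=
  ∀ ε : ℝ, 0 < ε → ∃ N, ∀ b, weight S N b < ε

theorem ErdosTendsto.eventually_forall_lt {S : ℕ → Set ℕ} {T : Set ℕ} (h : ErdosTendsto S T)
    (b : ℕ) : ∀ᶠ j in atTop, ∀ m < b, (m ∈ S j ↔ m ∈ T) := by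
  have := (Set.finite_lt_nat b).eventually_all (l := atTop)
    (p := fun m j => (m ∈ S j ↔ m ∈ T))
  exact this.2 fun m _ => h.1 m

theorem ErdosTendsto.isThin {S : ℕ → Set ℕ} {T : Set ℕ} (h : ErdosTendsto S T) : IsThin T := by
  intro ε hε
  obtain ⟨N, hN⟩ := h.2 ε hε
  refine ⟨N, fun b => ?_⟩
  obtain ⟨j, hj, hj'⟩ := (hN.and (h.eventually_forall_lt b)).exists
  rw [← weight_congr hj']
  exact hj b

theorem isThin_finset (F : Finset ℕ) : IsThin (F : Set ℕ) := by
  intro ε hε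
  refine ⟨F.sup id + 1, fun b => ?_⟩
  have : weight (F : Set ℕ) (F.sup id + 1) b = 0 := by
    refine Finset.sum_eq_zero fun m hm => Set.indicator_of_notMem (fun hmF => ?_) _
    have h1 : m ≤ F.sup id := Finset.le_sup (f := id) (Finset.mem_coe.1 hmF)
    have h2 := (Finset.mem_Ico.1 hm).1
    omega
  rwa [this]

/-- The harmonic sum of a set of natural numbers. -/
noncomputable def harmonicNorm (S : Set ℕ) : ℝ :=
  ∑' m, S.indicator (fun m : ℕ => 1 / ((m : ℝ) + 1)) m

theorem weight_zero_eq_sum_range (S : Set ℕ) (b : ℕ) : weight S 0 b =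
    ∑ m ∈ Finset.range b, S.indicator (fun m : ℕ => 1 / ((m : ℝ) + 1)) m := by
  rw [weight, Finset.range_eq_Ico]

theorem weight_zero_le_add (S : Set ℕ) (N b : ℕ) :
    weight S 0 b ≤ weight S 0 N + weight S N b := by
  rcases le_total N b with h | h
  · exact (Finset.sum_Ico_consecutive _ (Nat.zero_le N) h).ge
  · rw [weight_eq_zero_of_le S h, add_zero]
    exact Finset.sum_le_sum_of_subset_of_nonneg (Finset.Ico_subset_Ico_right h)
      fun m _ _ => indicator_harmonic_nonneg S m

theorem IsThin.summable {S : Set ℕ} (h : IsThin S) :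
    Summable (S.indicator (fun m : ℕ => 1 / ((m : ℝ) + 1))) := by
  obtain ⟨N, hN⟩ := h 1 one_pos
  refine summable_of_sum_range_le (c := weight S 0 N + 1) (indicator_harmonic_nonneg S)
    fun b => ?_
  rw [← weight_zero_eq_sum_range]
  linarith [weight_zero_le_add S N b, hN b]

theorem IsThin.weight_le_harmonicNorm {S : Set ℕ} (h : IsThin S) (a b : ℕ) :
    weight S a b ≤ harmonicNorm S :=
  h.summable.sum_le_tsum _ fun m _ => indicator_harmonic_nonneg S m

theorem harmonicNorm_le {S : Set ℕ} {N : ℕ} {ε : ℝ} (h : ∀ b, weight S N b ≤ ε) :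
    harmonicNorm S ≤ weight S 0 N + ε := by
  refine Real.tsum_le_of_sum_range_le (indicator_harmonic_nonneg S) fun b => ?_
  rw [← weight_zero_eq_sum_range]
  linarith [weight_zero_le_add S N b, h b]

theorem isThin_of_weight_le {S : Set ℕ} {c : ℝ} (h : ∀ b, weight S 0 b ≤ c) : IsThin S := by
  have hs : Summable (S.indicator (fun m : ℕ => 1 / ((m : ℝ) + 1))) :=
    summable_of_sum_range_le (c := c) (indicator_harmonic_nonneg S) fun b => by
      rw [← weight_zero_eq_sum_range]; exact h b
  intro ε hε
  obtain ⟨N, hN⟩ := ((hs.hasSum.tendsto_sum_nat).eventually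
    (lt_mem_nhds (sub_lt_self _ hε))).exists
  refine ⟨N, fun b => ?_⟩
  rcases le_total b N with hb | hb
  · rwa [weight_eq_zero_of_le S hb]
  · have h1 := Finset.sum_Ico_consecutive
      (S.indicator (fun m : ℕ => 1 / ((m : ℝ) + 1))) (Nat.zero_le N) hb
    have h2 := hs.sum_le_tsum (Finset.Ico 0 b) fun m _ => indicator_harmonic_nonneg S m
    rw [Finset.range_eq_Ico] at hN
    unfold weight
    linarith

theorem ErdosTendsto.tendsto_harmonicNorm {S : ℕ → Set ℕ} {T : Set ℕ} (h : ErdosTendsto S T)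
    (hS : ∀ j, IsThin (S j)) :
    Tendsto (fun j => harmonicNorm (S j)) atTop (𝓝 (harmonicNorm T)) := by
  rw [Metric.tendsto_atTop']
  intro ε hε
  obtain ⟨N, hN⟩ := h.2 (ε / 2) (by positivity)
  obtain ⟨M, hM⟩ := h.isThin (ε / 2) (by positivity)
  have hev : ∀ᶠ j in atTop, dist (harmonicNorm (S j)) (harmonicNorm T) < ε := by
    filter_upwards [hN, h.eventually_forall_lt N, h.eventually_forall_lt M] with j h1 h2 h3
    have e1 := harmonicNorm_le fun b => (h1 b).le
    have e2 := harmonicNorm_le fun b => (hM b).le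
    have e3 := (hS j).weight_le_harmonicNorm 0 M
    have e4 := h.isThin.weight_le_harmonicNorm 0 N
    rw [weight_congr h2] at e1
    rw [weight_congr h3] at e3
    rw [Real.dist_eq, abs_lt]
    constructor <;> linarith
  obtain ⟨j₀, hj₀⟩ := eventually_atTop.1 hev
  exact ⟨j₀, fun j hj => hj₀ j hj.le⟩

/-! ### Coding thin sets by functionals -/

/-- The property of `h : ℕ → ℕ` decided by the functional coding `S`: some interval
`[n, h (n + 1))` carries weight at least `1 / (h 0 + 1)`. -/
def IsHeavy (S : Set ℕ) (h : ℕ → ℕ) : Prop :=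
  ∃ n, 1 / ((h 0 : ℝ) + 1) ≤ weight S n (h (n + 1))

/-- When the tail of `S` from `N` on is light, heaviness only depends on `h 0, …, h N` and on
the elements of `S` below these values. -/
theorem IsHeavy.congr {S T : Set ℕ} {h h' : ℕ → ℕ} {N : ℕ} (H : IsHeavy S h)
    (hS : ∀ b, weight S N b < 1 / ((h 0 : ℝ) + 1)) (hh : ∀ n ≤ N, h n = h' n)
    (hST : ∀ n ≤ N, ∀ m < h n, m ∈ S ↔ m ∈ T) : IsHeavy T h' := by
  obtain ⟨n, hn⟩ := H
  have hnN : n < N := by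
    by_contra! hc
    exact absurd (weight_anti_left S hc (h (n + 1))) (not_le.2 ((hS _).trans_le hn))
  refine ⟨n, ?_⟩
  rwa [← hh 0 (Nat.zero_le N), ← hh (n + 1) hnN, ← weight_congr (hST (n + 1) hnN)]

theorem eventually_forall_le_eq (h : ℕ → ℕ) (N : ℕ) : ∀ᶠ h' in 𝓝 h, ∀ n ≤ N, h' n = h n := by
  have := (Set.finite_le_nat N).eventually_all (l := 𝓝 h) (p := fun n h' => h' n = h n)
  exact this.2 fun n _ => (continuous_apply n).continuousAt.eventually
    (isOpen_discrete {h n} |>.mem_nhds rfl)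

theorem IsThin.eventually_isHeavy_iff {S : Set ℕ} (hS : IsThin S) (h : ℕ → ℕ) :
    ∀ᶠ h' in 𝓝 h, (IsHeavy S h' ↔ IsHeavy S h) := by
  obtain ⟨N, hN⟩ := hS (1 / ((h 0 : ℝ) + 1)) (by positivity)
  filter_upwards [eventually_forall_le_eq h N] with h' hh
  exact ⟨fun H => H.congr (hh 0 (Nat.zero_le N) ▸ hN) hh fun _ _ _ _ => Iff.rfl,
    fun H => H.congr hN (fun n hn => (hh n hn).symm) fun _ _ _ _ => Iff.rfl⟩

open Classical in
/-- The functional `(ℕ → ℕ) → ℕ` that codes a thin set `S`: the characteristic function of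
`IsHeavy S`. -/
noncomputable def thinCode (S : Set ℕ) (hS : IsThin S) : C(ℕ → ℕ, ℕ) where
  toFun h := if IsHeavy S h then 1 else 0
  continuous_toFun := by
    refine IsLocallyConstant.continuous ((IsLocallyConstant.iff_eventually_eq _).2 fun h => ?_)
    filter_upwards [hS.eventually_isHeavy_iff h] with h' hh
    simp only [hh]

theorem thinCode_apply_ne_iff {S : Set ℕ} (hS : IsThin S) {h h₀ : ℕ → ℕ} (h₀S : ¬ IsHeavy S h₀) :
    thinCode S hS h ≠ thinCode S hS h₀ ↔ IsHeavy S h := by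
  simp [thinCode, h₀S]

theorem ErdosTendsto.tendsto_thinCode {S : ℕ → Set ℕ} {T : Set ℕ} (h : ErdosTendsto S T)
    (hS : ∀ j, IsThin (S j)) (hT : IsThin T) :
    Tendsto (fun j => thinCode (S j) (hS j)) atTop (𝓝 (thinCode T hT)) := by
  refine ContinuousMap.tendsto_of_tendstoLocallyUniformly fun u hu x => ?_
  obtain ⟨N, hN⟩ := h.2 (1 / ((x 0 : ℝ) + 1)) (by positivity)
  obtain ⟨M, hM⟩ := hT (1 / ((x 0 : ℝ) + 1)) (by positivity)
  refine ⟨_, eventually_forall_le_eq x (max N M), ?_⟩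
  have hb : ∀ n ≤ max N M, x n ≤ (Finset.range (max N M + 1)).sup x := fun n hn =>
    Finset.le_sup (Finset.mem_range.2 (Nat.lt_succ_of_le hn))
  filter_upwards [hN, h.eventually_forall_lt ((Finset.range (max N M + 1)).sup x)] with j h1 h2
  intro y hy
  have hy0 : y 0 = x 0 := hy 0 (Nat.zero_le _)
  have hST : ∀ n ≤ max N M, ∀ m < y n, m ∈ S j ↔ m ∈ T := fun n hn m hm =>
    h2 m ((hm.trans_eq (hy n hn)).trans_le (hb n hn))
  have : IsHeavy (S j) y ↔ IsHeavy T y :=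
    ⟨fun H => H.congr (N := max N M)
      (fun b => (weight_anti_left _ (le_max_left N M) b).trans_lt (hy0 ▸ h1 b))
      (fun _ _ => rfl) hST,
    fun H => H.congr (N := max N M)
      (fun b => (weight_anti_left _ (le_max_right N M) b).trans_lt (hy0 ▸ hM b))
      (fun _ _ => rfl) fun n hn m hm => (hST n hn m hm).symm⟩
  have e : thinCode T hT y = thinCode (S j) (hS j) y := by
    classical exact if_congr this.symm rfl rfl
  rw [e]
  exact refl_mem_uniformity hu

/-! ### Decoding arbitrary functionals -/

/-- The sequence `(i, 0, …, 0, k, 0, …)` with `k` in position `n + 1`. On it, the code of `S`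
tells whether `S ∩ [n, k)` has weight at least `1 / (i + 1)`. -/
def probe (i n k : ℕ) : ℕ → ℕ := fun l => if l = 0 then i else if l = n + 1 then k else 0

theorem isHeavy_probe {S : Set ℕ} {i n k : ℕ} :
    IsHeavy S (probe i n k) ↔ 1 / ((i : ℝ) + 1) ≤ weight S n k := by
  have h0 : (0 : ℝ) < 1 / ((i : ℝ) + 1) := by positivity
  constructor
  · rintro ⟨l, hl⟩
    by_cases h : l = n
    · simpa [probe, h] using hl
    · simp only [probe, if_true, Nat.add_right_cancel_iff, h, if_false, Nat.add_eq_zero_iff,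
        one_ne_zero, and_false, weight_eq_zero_of_le S (Nat.zero_le l)] at hl
      exact absurd hl (not_le.2 h0)
  · intro h
    exact ⟨n, by simpa [probe] using h⟩

theorem not_isHeavy_probe_zero (S : Set ℕ) (i : ℕ) : ¬ IsHeavy S (probe i 0 0) := by
  rw [isHeavy_probe, weight_eq_zero_of_le S le_rfl, not_le]
  positivity

theorem eventually_probe_mem {i : ℕ} {V : Set (ℕ → ℕ)} (hV : V ∈ 𝓝 (probe i 0 0)) :
    ∃ N, ∀ n, N ≤ n → ∀ k, probe i n k ∈ V := by
  rw [nhds_pi, Filter.mem_pi] at hV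
  obtain ⟨I, hI, t, ht, htV⟩ := hV
  obtain ⟨N, hN⟩ := hI.bddAbove
  refine ⟨N, fun n hn k => htV fun l hl => ?_⟩
  have hlN : l ≤ N := hN hl
  have : probe i n k l = probe i 0 0 l := by
    simp only [probe]
    split_ifs <;> first | rfl | omega
  rw [this]
  exact mem_of_mem_nhds (ht l)

/-- The functional `G` answers the question "does `[n, k)` carry weight at least
`1 / (i + 1)`?" positively. Comparison with the value at the limit point `(i, 0, 0, …)` makes
every continuous `G` answer negatively for all large `n`, uniformly in `k`. -/
def Affirms (G : C(ℕ → ℕ, ℕ)) (i n k : ℕ) : Prop := G (probe i n k) ≠ G (probe i 0 0)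

theorem affirms_thinCode {S : Set ℕ} (hS : IsThin S) {i n k : ℕ} :
    Affirms (thinCode S hS) i n k ↔ 1 / ((i : ℝ) + 1) ≤ weight S n k := by
  rw [Affirms, thinCode_apply_ne_iff hS (not_isHeavy_probe_zero S i), isHeavy_probe]

/-- The set that an arbitrary functional `G` claims to code. -/
def claimedSet (G : C(ℕ → ℕ, ℕ)) : Set ℕ := {m | Affirms G m m (m + 1)}

/-- Whenever an interval that ends with `m` carries weight at least `1 / (i + 1)` in the claimed
set, `G` affirms this. The bound `i ≤ m` makes the condition depend on finitely many values of `G`,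
so that it is locally constant in `G`. -/
def IsConsistentAt (G : C(ℕ → ℕ, ℕ)) (m : ℕ) : Prop :=
  ∀ i ≤ m, ∀ n ≤ m, 1 / ((i : ℝ) + 1) ≤ weight (claimedSet G) n (m + 1) → Affirms G i n (m + 1)

/-- The thin set read off from an arbitrary functional `G`: the claimed set, truncated where the
first inconsistency occurs. -/
def decode (G : C(ℕ → ℕ, ℕ)) : Set ℕ := {m | m ∈ claimedSet G ∧ ∀ l ≤ m, IsConsistentAt G l}

theorem decode_thinCode {S : Set ℕ} (hS : IsThin S) : decode (thinCode S hS) = S := by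
  have hc : claimedSet (thinCode S hS) = S := by
    ext m
    rw [claimedSet, Set.mem_ofPred_eq, affirms_thinCode]
    by_cases hm : m ∈ S
    · simp [weight_succ_of_mem le_rfl hm, weight_eq_zero_of_le, hm]
    · rw [weight_succ_of_notMem hm, weight_eq_zero_of_le S le_rfl]
      simp only [hm, iff_false, not_le]
      positivity
  ext m
  simp only [decode, IsConsistentAt, hc, affirms_thinCode, Set.mem_ofPred_eq]
  tauto

/-- An interval beyond `N` ends, within the decoded set, in an element `b ≥ i` at which `G` is
consistent; so if it were heavy, `G` would affirm this. -/
theorem weight_decode_lt {G : C(ℕ → ℕ, ℕ)} {i N : ℕ} (hi : i ≤ N)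
    (hG : ∀ n, N ≤ n → ∀ k, ¬ Affirms G i n k) (b : ℕ) :
    weight (decode G) N b < 1 / ((i : ℝ) + 1) := by
  have h0 : (0 : ℝ) < 1 / ((i : ℝ) + 1) := by positivity
  induction b with
  | zero => rwa [weight_eq_zero_of_le _ (Nat.zero_le N)]
  | succ b ih =>
    by_cases hb : b ∈ decode G
    · rcases lt_or_ge b N with hbN | hbN
      · rwa [weight_eq_zero_of_le _ hbN]
      · by_contra! hc
        refine hG N le_rfl (b + 1) (hb.2 b le_rfl i (hi.trans hbN) N hbN (hc.trans ?_))
        exact weight_mono_set (fun m hm => hm.1) _ _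
    · rwa [weight_succ_of_notMem hb]

/-- Negative answers are uniform along a convergent sequence: otherwise there are offending probes
tending to `(i, 0, 0, …)`, and on the compact set that they form with their limit the functionals
eventually agree with the constant value of the limit functional. -/
theorem exists_eventually_not_affirms {F : ℕ → C(ℕ → ℕ, ℕ)} {G : C(ℕ → ℕ, ℕ)}
    (h : Tendsto F atTop (𝓝 G)) (i : ℕ) :
    ∃ N, ∀ᶠ j in atTop, ∀ n, N ≤ n → ∀ k, ¬ Affirms (F j) i n k := by
  by_contra! hcon
  have hbad : ∀ N, ∃ j, N ≤ j ∧ ∃ n, N ≤ n ∧ ∃ k, Affirms (F j) i n k := fun N => by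
    obtain ⟨j, hj, h'⟩ := frequently_atTop.1 (not_eventually.1 (hcon N)) N
    push Not at h'
    exact ⟨j, hj, h'⟩
  choose j hj n hn k hk using hbad
  have hx : Tendsto (fun N => probe i (n N) (k N)) atTop (𝓝 (probe i 0 0)) := fun V hV => by
    obtain ⟨N, hN⟩ := eventually_probe_mem hV
    exact mem_atTop_sets.2 ⟨N, fun M hM => hN _ (hM.trans (hn M)) _⟩
  obtain ⟨N₀, hN₀⟩ := eventually_atTop.1 ((G.continuous.tendsto _ |>.comp hx).eventually
    (isOpen_discrete {G (probe i 0 0)} |>.mem_nhds rfl))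
  have hK := ((tendsto_add_atTop_iff_nat N₀).2 hx).isCompact_insert_range
  have hG : Set.MapsTo G (insert (probe i 0 0)
      (Set.range fun N => probe i (n (N + N₀)) (k (N + N₀)))) {G (probe i 0 0)} := by
    rintro _ (rfl | ⟨N, rfl⟩)
    · rfl
    · exact hN₀ _ (Nat.le_add_left N₀ N)
  obtain ⟨J, hJ⟩ := eventually_atTop.1
    (h.eventually (ContinuousMap.eventually_mapsTo hK (isOpen_discrete _) hG))
  have hm := hJ (j (J + N₀)) ((Nat.le_add_right J N₀).trans (hj _))
  exact hk (J + N₀) ((hm (Or.inr ⟨J, rfl⟩)).trans (hm (Or.inl rfl)).symm)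

theorem erdosTendsto_decode {F : ℕ → C(ℕ → ℕ, ℕ)} {G : C(ℕ → ℕ, ℕ)}
    (h : Tendsto F atTop (𝓝 G)) : ErdosTendsto (fun j => decode (F j)) (decode G) := by
  have hpt : ∀ x, ∀ᶠ j in atTop, F j x = G x := fun x =>
    ((ContinuousEvalConst.continuous_eval_const x).tendsto G |>.comp h).eventually
      (isOpen_discrete {G x} |>.mem_nhds rfl)
  have haff : ∀ i n k, ∀ᶠ j in atTop, (Affirms (F j) i n k ↔ Affirms G i n k) := fun i n k => by
    filter_upwards [hpt (probe i n k), hpt (probe i 0 0)] with j h1 h2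
    simp only [Affirms, h1, h2]
  constructor
  · intro m
    have hA : ∀ᶠ j in atTop, ∀ i ≤ m, ∀ n ≤ m, ∀ k ≤ m + 1,
        (Affirms (F j) i n k ↔ Affirms G i n k) := by
      refine (Set.finite_le_nat m).eventually_all.2 fun i _ => ?_
      refine (Set.finite_le_nat m).eventually_all.2 fun n _ => ?_
      exact (Set.finite_le_nat (m + 1)).eventually_all.2 fun k _ => haff i n k
    filter_upwards [hA] with j hj
    have hcl : ∀ l ≤ m, (l ∈ claimedSet (F j) ↔ l ∈ claimedSet G) := fun l hl =>
      hj l hl l hl (l + 1) (by omega)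
    have hcons : ∀ l ≤ m, (IsConsistentAt (F j) l ↔ IsConsistentAt G l) := fun l hl => by
      have hw : ∀ n, weight (claimedSet (F j)) n (l + 1) = weight (claimedSet G) n (l + 1) :=
        fun n => weight_congr fun r hr => hcl r (by omega)
      unfold IsConsistentAt
      refine forall₂_congr fun i hi => forall₂_congr fun n hn => ?_
      rw [hw, hj i (hi.trans hl) n (hn.trans hl) (l + 1) (by omega)]
    exact and_congr (hcl m le_rfl) (forall₂_congr hcons)
  · intro ε hε
    obtain ⟨i, hi⟩ := exists_nat_one_div_lt hε
    obtain ⟨N, hN⟩ := exists_eventually_not_affirms h i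
    refine ⟨max i N, hN.mono fun j hj b => (weight_decode_lt (le_max_left i N)
      (fun n hn k => hj n ((le_max_right i N).trans hn) k) b).trans hi⟩

theorem isThin_decode (G : C(ℕ → ℕ, ℕ)) : IsThin (decode G) :=
  (erdosTendsto_decode (tendsto_const_nhds (x := G) (f := atTop))).isThin

/-! ### A continuous function into the unit interval -/

/-- The continuous function on functionals that is `1 - ‖decode G‖`, truncated at `0`. -/
noncomputable def defect (G : C(ℕ → ℕ, ℕ)) : unitInterval :=
  Set.projIcc 0 1 zero_le_one (1 - harmonicNorm (decode G))

theorem isClosed_kleeneKreiselTwo_iff {A : Set KleeneKreiselTwo} :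
    IsClosed A ↔ @IsSeqClosed C(ℕ → ℕ, ℕ) ContinuousMap.compactOpen A := by
  rw [← isOpen_compl_iff]
  change Aᶜᶜ ∈ {A : Set C(ℕ → ℕ, ℕ) | IsSeqClosed A} ↔ _
  rw [compl_compl]
  rfl

theorem continuous_defect : Continuous (fun G : KleeneKreiselTwo => defect G) := by
  refine continuous_iff_isClosed.2 fun C hC => isClosed_kleeneKreiselTwo_iff.2 ?_
  intro F G hF hG
  refine hC.mem_of_tendsto (f := fun j => defect (F j)) (b := atTop) (x := defect G) ?_
    (Eventually.of_forall hF)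
  exact (continuous_projIcc.tendsto _).comp
    (((erdosTendsto_decode hG).tendsto_harmonicNorm fun j => isThin_decode (F j)).const_sub 1)

theorem defect_eq_zero_iff {G : C(ℕ → ℕ, ℕ)} : defect G = 0 ↔ 1 ≤ harmonicNorm (decode G) := by
  have : (0 : unitInterval) = ⟨0, Set.left_mem_Icc.2 zero_le_one⟩ := rfl
  rw [defect, this, Set.projIcc_eq_left zero_lt_one]
  constructor <;> intro h <;> linarith

/-! ### Erdős's argument -/

theorem weight_univ_unbounded (N : ℕ) : ∃ b, 1 ≤ weight Set.univ N b := by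
  obtain ⟨b, hb⟩ := ((tendsto_atTop.1 Real.tendsto_sum_range_one_div_nat_succ_atTop)
    (weight Set.univ 0 N + 1)).exists
  have h1 := weight_zero_le_add Set.univ N b
  have h2 : weight Set.univ 0 b = ∑ i ∈ Finset.range b, 1 / ((i : ℝ) + 1) := by
    simp [weight_zero_eq_sum_range]
  exact ⟨b, by linarith⟩

/-- Erdős's argument, one step: adding the numbers `N, N + 1, …` to a finite set with property
`P` destroys `P` at some point, since the harmonic series diverges. -/
theorem exists_boundary_finset {P : Finset ℕ → Prop}
    (hP : ∀ F, P F → harmonicNorm (F : Set ℕ) < 1) {F : Finset ℕ} (hF : P F) (N : ℕ) :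
    ∃ n, N ≤ n ∧ P (F ∪ Finset.Ico N n) ∧ ¬ P (insert n (F ∪ Finset.Ico N n)) := by
  by_contra! hcon
  have hall : ∀ n, N ≤ n → P (F ∪ Finset.Ico N n) := by
    refine Nat.le_induction (by simpa using hF) fun n hn ih => ?_
    have := hcon n hn ih
    rwa [← Finset.union_insert, Finset.insert_Ico_right_eq_Ico_add_one hn] at this
  obtain ⟨b, hb⟩ := weight_univ_unbounded N
  have hNb : N ≤ b := by
    by_contra! hc
    rw [weight_eq_zero_of_le _ hc.le] at hb
    exact absurd hb (by norm_num)
  have h1 := (isThin_finset (F ∪ Finset.Ico N b)).weight_le_harmonicNorm N b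
  have h2 : weight (↑(F ∪ Finset.Ico N b)) N b = weight Set.univ N b := by
    refine Finset.sum_congr rfl fun m hm => ?_
    have : m ∈ (↑(F ∪ Finset.Ico N b) : Set ℕ) := Finset.mem_coe.2 (Finset.mem_union_right _ hm)
    rw [Set.indicator_of_mem this, Set.indicator_of_mem (Set.mem_univ m)]
  linarith [hP _ (hall b hNb)]

/-- Erdős's argument: a property of finite sets that holds for `∅` and bounds the harmonic sum by
`1` has a thin set in its boundary, that is, a common limit of sets with and without it. -/
theorem exists_erdosTendsto_boundary {P : Finset ℕ → Prop} (h0 : P ∅)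
    (hP : ∀ F, P F → harmonicNorm (F : Set ℕ) < 1) :
    ∃ (A B : ℕ → Finset ℕ) (T : Set ℕ), (∀ j, P (A j)) ∧ (∀ j, ¬ P (B j)) ∧
      ErdosTendsto (fun j => (A j : Set ℕ)) T ∧ ErdosTendsto (fun j => (B j : Set ℕ)) T := by
  choose! nxt hle hin hout using fun F (hF : P F) N => exists_boundary_finset hP hF N
  obtain ⟨A, hA0, hAs⟩ : ∃ A : ℕ → Finset ℕ, A 0 = ∅ ∧
      ∀ j, A (j + 1) = A j ∪ Finset.Ico j (nxt (A j) j) :=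
    ⟨fun j => j.rec ∅ fun N F => F ∪ Finset.Ico N (nxt F N), rfl, fun _ => rfl⟩
  have hA : ∀ j, P (A j) := fun j => by
    induction j with
    | zero => rwa [hA0]
    | succ j ih => exact hAs j ▸ hin _ ih j
  have hmono : Monotone A := monotone_nat_of_le_succ fun j => by
    rw [hAs]
    exact Finset.subset_union_left
  let T : Set ℕ := ⋃ j : ℕ, (A j : Set ℕ)
  have hAT : ∀ j, (A j : Set ℕ) ⊆ T := fun j => Set.subset_iUnion (fun j => (A j : Set ℕ)) j
  have hmem : ∀ m, ∀ᶠ j in atTop, (m ∈ (A j : Set ℕ) ↔ m ∈ T) := fun m => by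
    by_cases hm : m ∈ T
    · obtain ⟨j₀, hj₀⟩ := Set.mem_iUnion.1 hm
      filter_upwards [eventually_ge_atTop j₀] with j hj
      exact iff_of_true (hmono hj hj₀) hm
    · exact Eventually.of_forall fun j => iff_of_false (fun h => hm (hAT j h)) hm
  have hT : IsThin T := by
    refine isThin_of_weight_le (c := 1) fun b => ?_
    have hb : ∀ᶠ j in atTop, ∀ m < b, (m ∈ (A j : Set ℕ) ↔ m ∈ T) :=
      (Set.finite_lt_nat b).eventually_all.2 fun m _ => hmem m
    obtain ⟨j, hj⟩ := hb.exists
    rw [← weight_congr hj]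
    exact ((isThin_finset (A j)).weight_le_harmonicNorm 0 b).trans (hP _ (hA j)).le
  refine ⟨fun j => A (j + 1), fun j => insert (nxt (A j) j) (A (j + 1)), T, fun j => hA (j + 1),
    fun j => by simpa only [hAs] using hout _ (hA j) j,
    ⟨fun m => (tendsto_add_atTop_nat 1).eventually (hmem m), ?_⟩,
    ⟨fun m => ?_, ?_⟩⟩
  · intro ε hε
    obtain ⟨N, hN⟩ := hT ε hε
    exact ⟨N, Eventually.of_forall fun j b => (weight_mono_set (hAT _) N b).trans_lt (hN b)⟩
  · filter_upwards [(tendsto_add_atTop_nat 1).eventually (hmem m), eventually_gt_atTop m]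
      with j hj hmj
    have : m ≠ nxt (A j) j := ((hmj.trans_le (hle _ (hA j) j))).ne
    rw [← hj]
    simp [this]
  · intro ε hε
    obtain ⟨N, hN⟩ := hT (ε / 2) (by positivity)
    obtain ⟨i, hi⟩ := exists_nat_one_div_lt (half_pos hε)
    refine ⟨N, ?_⟩
    filter_upwards [eventually_ge_atTop i] with j hj b
    have h1 := weight_insert_le (A (j + 1) : Set ℕ) (nxt (A j) j) N b
    have h2 := (weight_mono_set (hAT (j + 1)) N b).trans_lt (hN b)
    have h3 : 1 / ((nxt (A j) j : ℝ) + 1) ≤ 1 / ((i : ℝ) + 1) := by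
      have : (i : ℝ) ≤ nxt (A j) j := by exact_mod_cast hj.trans (hle _ (hA j) j)
      gcongr
    rw [Finset.coe_insert]
    linarith

/-! ### Failure of Normann's condition -/

theorem theorem4p2 : ¬ NormannCondition KleeneKreiselTwo := by
  intro hN
  obtain ⟨𝒞, h𝒞, hA⟩ := hN {G | defect G = 0} ⟨fun G => defect G, continuous_defect, rfl⟩
  let c : Finset ℕ → KleeneKreiselTwo := fun F => thinCode F (isThin_finset F)
  have hc : ∀ F, c F ∈ {G : KleeneKreiselTwo | defect G = 0} ↔ 1 ≤ harmonicNorm (F : Set ℕ) :=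
    fun F => by
      change defect (thinCode F (isThin_finset F)) = 0 ↔ _
      rw [defect_eq_zero_iff, decode_thinCode]
  have h0 : c ∅ ∉ ⋂₀ 𝒞 := by
    rw [← hA, hc]
    simp [harmonicNorm]
  obtain ⟨C, hC, h0C⟩ : ∃ C ∈ 𝒞, c ∅ ∉ C := by simpa using h0
  obtain ⟨A, B, T, hAj, hBj, hAT, hBT⟩ := exists_erdosTendsto_boundary (P := fun F => c F ∉ C) h0C
    fun F hF => not_le.1 fun h => hF (by
      have := (hc F).2 h
      rw [hA] at this
      exact this C hC)
  have hT := hAT.isThin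
  have h1 := isClosed_kleeneKreiselTwo_iff.1 (h𝒞 C hC).compl.isClosed hAj
    (hAT.tendsto_thinCode (fun j => isThin_finset (A j)) hT)
  have h2 := isClosed_kleeneKreiselTwo_iff.1 (h𝒞 C hC).isClosed (fun j => not_not.1 (hBj j))
    (hBT.tendsto_thinCode (fun j => isThin_finset (B j)) hT)
  exact h1 h2
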